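/- Let $n\ge 1$ and let $\mathbf R^{n+1}_1$ be $\mathbf R^{n+1}$ with the Lorentz metric $\langle x,y\rangle_L=x^1y^1+\cdots+x^ny^n-x^{n+1}y^{n+1}$. Let $D\subset\mathbf R^n$ be a domain (non-empty, open, connected) whose closure $\overline D$ is compact and whose boundary $\partial D$ is smooth, i.e. near each $p\in\partial D$ the set $D$ is the sublevel set $\{\rho<0\}$ of a $C^\infty$ function $\rho$ with $d\rho(p)\neq 0$. Let $\psi$ be a real-valued $C^2$ function on an open set $\Omega\supset\overline D$, and let $\Gamma_\psi=\{(u,\psi(u)) : u\in\Omega\}\subset\mathbf R^{n+1}_1$ be its graph. Call $\Gamma_\psi$ space-like (resp. time-like) if the metric $g$ induced on $\Omega$ by $u\mapsto(u,\psi(u))$ is Riemannian (resp. Lorentzian, i.e. of signature $(n-1,1)$) at every point. In either case let $N=-(\nabla\psi,1)/\sqrt{|1-|\nabla\psi|^2|}$ be the unit normal, and let $H=\frac1n\sum_{i,j}g^{ij}h_{ij}$ be the mean curvature, where $f(u)=(u,\psi(u))$, $h_{ij}=\langle\partial_i\partial_jf,N\rangle_L$, and $(g^{ij})$ is the inverse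 of the matrix $(g_{ij})$, $g_{ij}=\langle\partial_if,\partial_jf\rangle_L$. (The other choice of unit normal only changes the sign of $H$.) Let $V(\overline D)$ be the $n$-dimensional volume of $\overline D$ and $A(\partial D)$ the $(n-1)$-dimensional volume of $\partial D$ (the number of points if $n=1$); $A(\partial D)$ is finite. If $\Gamma_\psi$ is space-like, put $m_D=\max_{\overline D}|\nabla\psi|$; if $\Gamma_\psi$ is time-like, put $m_D=\min_{\overline D}|\nabla\psi|$. In both cases the extrema exist, and $$\min_{\overline D}|H|\;\le\;\frac1n\,\frac{m_D}{\sqrt{|1-m_D^2|}}\,\frac{A(\partial D)}{V(\overline D)}.$$ -/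

import Mathlib

open scoped MeasureTheory ContDiff

noncomputable section

namespace LorentzGraph

/-- The Lorentz metric `x¹y¹ + ⋯ + xⁿyⁿ - xⁿ⁺¹yⁿ⁺¹` on `ℝⁿ⁺¹ = ℝⁿ × ℝ`
(the last coordinate is the second component of the pair). -/
def lorentz {n : ℕ} (x y : EuclideanSpace ℝ (Fin n) × ℝ) : ℝ :=
  (∑ i, x.1 i * y.1 i) - x.2 * y.2

/-- The `i`-th standard unit vector of `ℝⁿ`. -/
def stdVec {n : ℕ} (i : Fin n) : EuclideanSpace ℝ (Fin n) := EuclideanSpace.single i (1 : ℝ)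

/-- The parametrization `u ↦ (u, ψ u)` of the graph of `ψ`. -/
def graphMap {n : ℕ} (ψ : EuclideanSpace ℝ (Fin n) → ℝ) (u : EuclideanSpace ℝ (Fin n)) :
    EuclideanSpace ℝ (Fin n) × ℝ :=
  (u, ψ u)

/-- The induced metric: the pull-back of the Lorentz metric by the graph map, at the point `u`. -/
def inducedMetric {n : ℕ} (ψ : EuclideanSpace ℝ (Fin n) → ℝ) (u v w : EuclideanSpace ℝ (Fin n)) :
    ℝ :=
  lorentz (fderiv ℝ (graphMap ψ) u v) (fderiv ℝ (graphMap ψ) u w)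

/-- The graph of `ψ` over `Ω` is space-like: the induced metric is Riemannian. -/
def IsSpaceLike {n : ℕ} (ψ : EuclideanSpace ℝ (Fin n) → ℝ) (Ω : Set (EuclideanSpace ℝ (Fin n))) :
    Prop :=
  ∀ u ∈ Ω, ∀ v, v ≠ 0 → 0 < inducedMetric ψ u v v

/-- The graph of `ψ` over `Ω` is time-like: the induced metric is Lorentzian, that is, of
signature `(n - 1, 1)` (some vector is time-like, and the metric is positive definite on its
orthogonal complement). -/
def IsTimeLike {n : ℕ} (ψ : EuclideanSpace ℝ (Fin n) → ℝ) (Ω : Set (EuclideanSpace ℝ (Fin n))) :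
    Prop :=
  ∀ u ∈ Ω, ∃ v, inducedMetric ψ u v v < 0 ∧
    ∀ w, w ≠ 0 → inducedMetric ψ u v w = 0 → 0 < inducedMetric ψ u w w

/-- The unit normal field `-(∇ψ, 1) / √|1 - |∇ψ|²|` of a space-like or time-like graph. -/
def unitNormal {n : ℕ} (ψ : EuclideanSpace ℝ (Fin n) → ℝ) (u : EuclideanSpace ℝ (Fin n)) :
    EuclideanSpace ℝ (Fin n) × ℝ :=
  -((√|1 - ‖gradient ψ u‖ ^ 2|)⁻¹ • (gradient ψ u, (1 : ℝ)))

/-- The matrix `g i j` of the first fundamental form in the coordinates `u`. -/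
def firstForm {n : ℕ} (ψ : EuclideanSpace ℝ (Fin n) → ℝ) (u : EuclideanSpace ℝ (Fin n)) :
    Matrix (Fin n) (Fin n) ℝ :=
  Matrix.of fun i j => inducedMetric ψ u (stdVec i) (stdVec j)

/-- The matrix `h i j = ⟨∂ᵢ∂ⱼf, N⟩` of the second fundamental form, where `f` is the graph map and
`N` the unit normal field. -/
def secondForm {n : ℕ} (ψ : EuclideanSpace ℝ (Fin n) → ℝ) (u : EuclideanSpace ℝ (Fin n)) :
    Matrix (Fin n) (Fin n) ℝ :=
  Matrix.of fun i j =>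
    lorentz (fderiv ℝ (fun v => fderiv ℝ (graphMap ψ) v (stdVec j)) u (stdVec i)) (unitNormal ψ u)

/-- The mean curvature `H = (1/n) ∑ gⁱʲ hᵢⱼ` of the graph of `ψ` at the point over `u`. With the
chosen unit normal, `n H` is the divergence of `∇ψ / √|1 - |∇ψ|²|` in the space-like and in the
time-like case; the opposite normal changes the sign of `H`. -/
def meanCurvature {n : ℕ} (ψ : EuclideanSpace ℝ (Fin n) → ℝ) (u : EuclideanSpace ℝ (Fin n)) : ℝ :=
  (1 / (n : ℝ)) * ((firstForm ψ u)⁻¹ * secondForm ψ u).trace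

/-- `D` has smooth boundary: near each of its boundary points, `D` is the sublevel set `{ρ < 0}` of
a smooth function `ρ` with non-vanishing differential at that point. -/
def HasSmoothBoundary {n : ℕ} (D : Set (EuclideanSpace ℝ (Fin n))) : Prop :=
  ∀ p ∈ frontier D, ∃ (U : Set (EuclideanSpace ℝ (Fin n))) (ρ : EuclideanSpace ℝ (Fin n) → ℝ),
    IsOpen U ∧ p ∈ U ∧ ContDiffOn ℝ ∞ ρ U ∧ fderiv ℝ ρ p ≠ 0 ∧ D ∩ U = {x ∈ U | ρ x < 0}

/-- The `n`-dimensional volume of a subset of `ℝⁿ`. -/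
def vol {n : ℕ} (S : Set (EuclideanSpace ℝ (Fin n))) : ℝ :=
  (MeasureTheory.volume S).toReal

/-- The `(n - 1)`-dimensional volume of a subset of `ℝⁿ`, `n ≥ 1`: the Hausdorff measure, normalized
to agree with Lebesgue measure on hyperplanes. -/
def area {n : ℕ} (S : Set (EuclideanSpace ℝ (Fin n))) : ℝ :=
  ((μHE[n - 1] : MeasureTheory.Measure (EuclideanSpace ℝ (Fin n))) S).toReal

end LorentzGraph

end

/-!
Write `X = ∇ψ / √|1 - |∇ψ|²|`. The first fundamental form is the rank-one perturbation `1 - ∇ψ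
∇ψᵀ` of the identity, so its inverse is explicit and `n H = div X`, for space-like and time-like
graphs alike (`meanCurvature_eq_divergence`). If `H` has no zero on the connected set `closure D`,
it has a constant sign there, hence `n min |H| V(D) ≤ |∫_D div X|`. By the divergence theorem the
right-hand side is at most `sup |X| · A(∂D)`. Finally `|X| = t / √|1 - t²|` with `t = |∇ψ|`, which
increases for `t < 1` and decreases for `t > 1`, so that its supremum is the value at `m_D`.

What is needed of the divergence theorem is the inequality `∫_D div X ≤ sup |X| · A(∂D)` with the
Hausdorff measure of the boundary on the right (`HasSmoothBoundary.integral_divergence_le`). This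
inequality is proved without surface integrals and without an area formula. Fix `η > 0`. Near each
boundary point `D` is the region below the graph of an `η`-Lipschitz function `f` over the tangent
hyperplane (`exists_sublevel_eq_depth_pos`), and a smooth partition of unity reduces the claim to
a field `Y` supported in such a neighbourhood.

For such a field the indicator function of the region is approximated by a Lipschitz cut-off
depending only on the height below the graph. Integrating by parts against it bounds `∫_D div Y`
by `(1 + η) ∫ |Y(y, f y)| dy`, an integral over the hyperplane (`integral_divergence_depth_le`).
The orthogonal projection of the graph to the hyperplane is 1-Lipschitz, so it does not increase
Hausdorff measure, and the last integral is at most `∫_{∂D} |Y|` (`lintegral_graphOver_le`).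
Summing over the partition and letting `η` tend to zero gives the sharp constant. The graph
parametrization is Lipschitz as well, which shows that `A(∂D)` is finite, and therefore that `∂D`
is Lebesgue-null.
-/

namespace LorentzGraph

open MeasureTheory Filter Topology Set
open scoped ENNReal NNReal

/-! ### Graphs over hyperplanes and sublevel sets -/

section Graphs

variable {E : Type*} [NormedAddCommGroup E] [InnerProductSpace ℝ E]

/-- The signed distance, measured along `ν`, of the point `x` from the graph over the hyperplane
`νᗮ` of the function `f`. It is positive exactly at the points below the graph. -/
noncomputable def depth (ν : E) (f : (ℝ ∙ ν)ᗮ → ℝ) (x : E) : ℝ :=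
  f ((ℝ ∙ ν)ᗮ.orthogonalProjectionOnto x) - inner ℝ ν x

/-- The parametrization by the hyperplane `νᗮ` of the graph of `f` in the direction `ν`. -/
noncomputable def graphOver (ν : E) (f : (ℝ ∙ ν)ᗮ → ℝ) (y : (ℝ ∙ ν)ᗮ) : E :=
  (y : E) + f y • ν

lemma inner_coe_orthogonal (ν : E) (y : (ℝ ∙ ν)ᗮ) : inner ℝ ν (y : E) = 0 :=
  Submodule.mem_orthogonal_singleton_iff_inner_right.1 y.2

lemma projection_add_smul (ν : E) (y : (ℝ ∙ ν)ᗮ) (t : ℝ) :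
    (ℝ ∙ ν)ᗮ.orthogonalProjectionOnto ((y : E) + t • ν) = y := by
  have : (ℝ ∙ ν)ᗮ.orthogonalProjectionOnto (t • ν) = 0 := by
    apply Submodule.orthogonalProjectionOnto_apply_of_mem_orthogonal
    rw [Submodule.orthogonal_orthogonal]
    exact Submodule.smul_mem _ _ (Submodule.mem_span_singleton_self ν)
  rw [map_add, this, add_zero]
  exact Submodule.orthogonalProjectionOnto_mem_subspace_eq_self _

lemma inner_add_smul {ν : E} (hν : ‖ν‖ = 1) (y : (ℝ ∙ ν)ᗮ) (t : ℝ) :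
    inner ℝ ν ((y : E) + t • ν) = t := by
  rw [inner_add_right, inner_coe_orthogonal, inner_smul_right, real_inner_self_eq_norm_sq, hν]
  simp

lemma projection_add_inner_smul {ν : E} (hν : ‖ν‖ = 1) (x : E) :
    ((ℝ ∙ ν)ᗮ.orthogonalProjectionOnto x : E) + inner ℝ ν x • ν = x := by
  have h := Submodule.starProjection_add_starProjection_orthogonal (K := ℝ ∙ ν) x
  rw [Submodule.starProjection_unit_singleton ℝ hν] at h
  rw [add_comm]
  exact h

lemma depth_add_smul {ν : E} (hν : ‖ν‖ = 1) (f : (ℝ ∙ ν)ᗮ → ℝ) (y : (ℝ ∙ ν)ᗮ) (t : ℝ) :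
    depth ν f ((y : E) + t • ν) = f y - t := by
  rw [depth, projection_add_smul, inner_add_smul hν]

lemma depth_graphOver {ν : E} (hν : ‖ν‖ = 1) (f : (ℝ ∙ ν)ᗮ → ℝ) (y : (ℝ ∙ ν)ᗮ) :
    depth ν f (graphOver ν f y) = 0 := by
  rw [graphOver, depth_add_smul hν, sub_self]

lemma depth_sub_smul {ν : E} (hν : ‖ν‖ = 1) (f : (ℝ ∙ ν)ᗮ → ℝ) (x : E) (s : ℝ) :
    depth ν f (x - s • ν) = depth ν f x + s := by
  conv_lhs => rw [← projection_add_inner_smul hν x, add_sub_assoc, ← sub_smul, depth_add_smul hν]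
  rw [depth]; ring

lemma graphOver_projection {ν : E} (hν : ‖ν‖ = 1) (f : (ℝ ∙ ν)ᗮ → ℝ) {x : E}
    (hx : depth ν f x = 0) :
    graphOver ν f ((ℝ ∙ ν)ᗮ.orthogonalProjectionOnto x) = x := by
  rw [graphOver, sub_eq_zero.1 hx, projection_add_inner_smul hν]

lemma lipschitzWith_depth {ν : E} (hν : ‖ν‖ = 1) {f : (ℝ ∙ ν)ᗮ → ℝ} {η : ℝ≥0}
    (hf : LipschitzWith η f) : LipschitzWith (1 + η) (depth ν f) := by
  have hP : LipschitzWith 1 ((ℝ ∙ ν)ᗮ.orthogonalProjectionOnto) :=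
    LipschitzWith.of_dist_le_mul fun x y => by
      rw [dist_eq_norm, dist_eq_norm, ← map_sub, NNReal.coe_one, one_mul]
      exact Submodule.norm_orthogonalProjectionOnto_apply_le _ _
  have hi : LipschitzWith 1 (fun x : E => inner ℝ ν x) :=
    LipschitzWith.of_dist_le_mul fun x y => by
      rw [dist_eq_norm, dist_eq_norm, ← inner_sub_right, NNReal.coe_one]
      simpa [hν] using norm_inner_le_norm (𝕜 := ℝ) ν (x - y)
  have := (hf.comp hP).sub hi
  rw [mul_one, add_comm] at this
  exact this

lemma lipschitzWith_graphOver {ν : E} (hν : ‖ν‖ = 1) {f : (ℝ ∙ ν)ᗮ → ℝ} {η : ℝ≥0}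
    (hf : LipschitzWith η f) : LipschitzWith (1 + η) (graphOver ν f) := by
  refine LipschitzWith.of_dist_le_mul fun x y => ?_
  have h1 := hf.dist_le_mul x y
  have : graphOver ν f x - graphOver ν f y = ((x - y : (ℝ ∙ ν)ᗮ) : E) + (f x - f y) • ν := by
    simp only [graphOver, Submodule.coe_sub, sub_smul]; abel
  rw [dist_eq_norm, this]
  refine (norm_add_le _ _).trans ?_
  rw [norm_smul, hν, mul_one, ← dist_eq_norm, NNReal.coe_add, add_mul, NNReal.coe_one, one_mul]
  gcongr
  rw [dist_eq_norm]; rfl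

/-- Near a point where the differential of `ρ` does not vanish, the sublevel set `{ρ < 0}` is the
region below the graph of a function over the tangent hyperplane, and the Lipschitz constant of
that function can be made as small as one likes. Because `ρ` is strictly differentiable at the
point, two zeros of `ρ` near it differ by a vector almost orthogonal to `ν`, so the zero set is a
graph over some part of `νᗮ`; the intermediate value theorem along the lines parallel to `ν` shows
that this part is large enough. -/
lemma exists_sublevel_eq_depth_pos [FiniteDimensional ℝ E] {ρ : E → ℝ} {p : E}
    (hρ : HasStrictFDerivAt ρ (fderiv ℝ ρ p) p)
    (hcont : ∀ᶠ x in 𝓝 p, ContinuousAt ρ x)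
    (h0 : ρ p = 0) (hne : fderiv ℝ ρ p ≠ 0) {η : ℝ≥0} (hη : 0 < η) :
    ∃ (ν : E) (f : (ℝ ∙ ν)ᗮ → ℝ) (U : Set E), ‖ν‖ = 1 ∧ LipschitzWith η f ∧ IsOpen U ∧ p ∈ U ∧
      ∀ x ∈ U, ρ x < 0 ↔ 0 < depth ν f x := by
  set g : E := (InnerProductSpace.toDual ℝ E).symm (fderiv ℝ ρ p) with hg
  have hgd : ∀ v, fderiv ℝ ρ p v = inner ℝ g v := fun v => by simp [hg]
  have hg0 : g ≠ 0 := by simpa [hg] using hne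
  set c := ‖g‖ with hc
  have hcpos : 0 < c := norm_pos_iff.2 hg0
  set ν : E := c⁻¹ • g with hνdef
  have hν : ‖ν‖ = 1 := by rw [hνdef, norm_smul, norm_inv, norm_norm, inv_mul_cancel₀ hcpos.ne']
  have hgν : ∀ v, fderiv ℝ ρ p v = c * inner ℝ ν v := fun v => by
    rw [hgd, hνdef, real_inner_smul_left, mul_inv_cancel_left₀ hcpos.ne']
  -- With `|⟪ν, d⟫| ≤ κ ‖d‖ ≤ κ (‖P d‖ + |⟪ν, d⟫|)`, the slope is at most `κ / (1 - κ) ≤ η`.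
  obtain ⟨κ, hκ0, hκ2, hκη⟩ : ∃ κ : ℝ, 0 < κ ∧ κ ≤ 1 / 2 ∧ κ ≤ η * (1 - κ) := by
    refine ⟨min (1 / 2) (η / 2), by positivity, min_le_left _ _, ?_⟩
    have h1 := min_le_left (1 / 2 : ℝ) (η / 2)
    have h2 := min_le_right (1 / 2 : ℝ) (η / 2)
    have : (0 : ℝ) < η := hη
    nlinarith
  have hstr := hρ.isLittleO.def (mul_pos hκ0 hcpos)
  rw [nhds_prod_eq] at hstr
  obtain ⟨V, hV, hVs⟩ := eventually_prod_self_iff'.1 hstr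
  obtain ⟨r, hr, hrV⟩ := Metric.mem_nhds_iff.1 (Filter.inter_mem hV hcont)
  set B := Metric.ball p r with hB
  have hlin : ∀ x ∈ B, ∀ y ∈ B, |ρ x - ρ y - c * inner ℝ ν (x - y)| ≤ κ * c * ‖x - y‖ :=
    fun x hx y hy => by
      have := hVs x (hrV hx).1 y (hrV hy).1
      rwa [hgν, Real.norm_eq_abs] at this
  set P := (ℝ ∙ ν)ᗮ.orthogonalProjectionOnto with hP
  set Z : Set E := {x ∈ B | ρ x = 0} with hZ
  have hcone : ∀ z ∈ Z, ∀ w ∈ Z, |inner ℝ ν z - inner ℝ ν w| ≤ η * ‖P z - P w‖ := by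
    intro z hz w hw
    have h1 := hlin z hz.1 w hw.1
    rw [hz.2, hw.2, sub_self, zero_sub, abs_neg, abs_mul, abs_of_pos hcpos] at h1
    have h2 : |inner ℝ ν (z - w)| ≤ κ * ‖z - w‖ := by
      refine le_of_mul_le_mul_left (h1.trans_eq ?_) hcpos
      ring
    have h3 : ‖z - w‖ ≤ ‖P z - P w‖ + |inner ℝ ν (z - w)| := by
      conv_lhs => rw [← projection_add_inner_smul hν (z - w)]
      refine (norm_add_le _ _).trans ?_
      rw [norm_smul, hν, mul_one, ← map_sub]
      rfl
    rw [← inner_sub_right]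
    set a := |inner ℝ ν (z - w)|
    have h4 : (1 - κ) * a ≤ κ * ‖P z - P w‖ := by nlinarith
    have h5 : κ * ‖P z - P w‖ ≤ η * (1 - κ) * ‖P z - P w‖ := by gcongr
    have h6 : 0 < 1 - κ := by linarith
    exact le_of_mul_le_mul_left (by linarith) h6
  set f₀ : (ℝ ∙ ν)ᗮ → ℝ := fun y => inner ℝ ν (Function.invFunOn P Z y) with hf₀
  have hinv : ∀ z ∈ Z, Function.invFunOn P Z (P z) ∈ Z ∧ P (Function.invFunOn P Z (P z)) = P z :=
    fun z hz => ⟨Function.invFunOn_mem ⟨z, hz, rfl⟩, Function.invFunOn_eq ⟨z, hz, rfl⟩⟩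
  have hf₀L : LipschitzOnWith η f₀ (P '' Z) := by
    refine LipschitzOnWith.of_dist_le_mul ?_
    rintro _ ⟨z, hz, rfl⟩ _ ⟨w, hw, rfl⟩
    have := hcone _ (hinv z hz).1 _ (hinv w hw).1
    rw [(hinv z hz).2, (hinv w hw).2] at this
    rw [Real.dist_eq, dist_eq_norm]
    exact this
  obtain ⟨f, hfL, hfeq⟩ := hf₀L.extend_real
  have hfZ : ∀ z ∈ Z, f (P z) = inner ℝ ν z := fun z hz => by
    rw [← hfeq ⟨z, hz, rfl⟩]
    have := hcone _ (hinv z hz).1 _ hz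
    rw [(hinv z hz).2, sub_self, norm_zero, mul_zero] at this
    exact sub_eq_zero.1 (abs_nonpos_iff.1 this)
  -- On each line parallel to `ν` meeting the ball of radius `r / 5`, the function `ρ` changes sign
  -- within distance `3 r / 5`, hence still inside `B`.
  refine ⟨ν, f, Metric.ball p (r / 5), hν, hfL, Metric.isOpen_ball,
    Metric.mem_ball_self (by positivity), fun x hx => ?_⟩
  rw [Metric.mem_ball, dist_eq_norm] at hx
  have hxB : ∀ s ∈ Icc (-(3 * (r / 5))) (3 * (r / 5)), x + s • ν ∈ B := fun s hs => by
    rw [hB, Metric.mem_ball, dist_eq_norm, add_sub_right_comm]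
    refine (norm_add_le _ _).trans_lt ?_
    rw [norm_smul, hν, mul_one, Real.norm_eq_abs]
    have := abs_le.2 hs
    linarith
  have hx0 : x ∈ B := by simpa using hxB 0 ⟨by linarith, by linarith⟩
  have hincr : ∀ s ∈ Icc (-(3 * (r / 5))) (3 * (r / 5)),
      |ρ (x + s • ν) - ρ x - c * s| ≤ c * |s| / 2 := fun s hs => by
    have := hlin _ (hxB s hs) x hx0
    rw [add_sub_cancel_left, inner_smul_right, real_inner_self_eq_norm_sq, hν, norm_smul, hν,
      one_pow, mul_one, mul_one, Real.norm_eq_abs] at this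
    refine this.trans ?_
    have := mul_le_mul_of_nonneg_right hκ2 (mul_nonneg hcpos.le (abs_nonneg s))
    linarith
  have hρx : |ρ x| < c * (3 * (r / 5)) / 2 := by
    have h1 := hlin x hx0 p (Metric.mem_ball_self hr)
    rw [h0, sub_zero] at h1
    have h2 : |c * inner ℝ ν (x - p)| ≤ c * ‖x - p‖ := by
      rw [abs_mul, abs_of_pos hcpos]
      gcongr
      simpa [hν] using abs_real_inner_le_norm ν (x - p)
    have h3 : |ρ x| ≤ |ρ x - c * inner ℝ ν (x - p)| + |c * inner ℝ ν (x - p)| := by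
      simpa using abs_add_le (ρ x - c * inner ℝ ν (x - p)) (c * inner ℝ ν (x - p))
    have h4 : κ * c * ‖x - p‖ ≤ 1 / 2 * c * ‖x - p‖ := by gcongr
    have h5 : c * ‖x - p‖ < c * (r / 5) := by gcongr
    linarith
  have hcontline : ContinuousOn (fun s : ℝ => ρ (x + s • ν))
      (Icc (-(3 * (r / 5))) (3 * (r / 5))) := fun s hs => by
    have h1 : ContinuousAt ρ (x + s • ν) := (hrV (hxB s hs)).2
    exact (ContinuousAt.comp (f := fun s : ℝ => x + s • ν) h1 (by fun_prop)).continuousWithinAt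
  obtain ⟨s, hs, hs0⟩ : ∃ s ∈ Icc (-(3 * (r / 5))) (3 * (r / 5)), ρ (x + s • ν) = 0 := by
    have hle : -(3 * (r / 5)) ≤ 3 * (r / 5) := by linarith
    have h1 := abs_le.1 (hincr _ (left_mem_Icc.2 hle))
    have h2 := abs_le.1 (hincr _ (right_mem_Icc.2 hle))
    rw [abs_neg, abs_of_pos (by positivity : (0 : ℝ) < 3 * (r / 5))] at h1
    rw [abs_of_pos (by positivity : (0 : ℝ) < 3 * (r / 5))] at h2
    have h3 := abs_lt.1 hρx
    exact intermediate_value_Icc hle hcontline ⟨by linarith, by linarith⟩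
  have hz : x + s • ν ∈ Z := ⟨hxB s hs, hs0⟩
  have hPz : P (x + s • ν) = P x := by
    conv_lhs => rw [← projection_add_inner_smul hν x, add_assoc, ← add_smul]
    exact projection_add_smul _ _ _
  have hdepth : depth ν f x = s := by
    rw [depth, ← hP, ← hPz, hfZ _ hz, inner_add_right, inner_smul_right,
      real_inner_self_eq_norm_sq, hν]
    ring
  have h1 := hincr s hs
  rw [hs0, zero_sub] at h1
  rw [hdepth]
  obtain ⟨h1, h2⟩ := abs_le.1 h1
  rcases lt_trichotomy s 0 with h | h | h
  · rw [abs_of_neg h] at h1 h2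
    have := mul_neg_of_pos_of_neg hcpos h
    constructor <;> intro <;> linarith
  · simp only [h, abs_zero, mul_zero, zero_div, sub_zero] at h1 h2 ⊢
    constructor <;> intro <;> linarith
  · rw [abs_of_pos h] at h1 h2
    have := mul_pos hcpos h
    constructor <;> intro <;> linarith

end Graphs

/-! ### Hausdorff measure of graphs and integrals over thin layers -/

section GraphMeasure

variable {E : Type*} [NormedAddCommGroup E] [InnerProductSpace ℝ E] [FiniteDimensional ℝ E]
  [MeasurableSpace E] [BorelSpace E]

lemma measurePreserving_add_smul {ν : E} (hν : ‖ν‖ = 1) :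
    MeasurePreserving (fun q : (ℝ ∙ ν)ᗮ × ℝ => (q.1 : E) + q.2 • ν) := by
  have h1 : MeasurePreserving
      (Prod.map (LinearIsometryEquiv.toSpanUnitSingleton (𝕜 := ℝ) ν hν) id :
        ℝ × (ℝ ∙ ν)ᗮ → (ℝ ∙ ν) × (ℝ ∙ ν)ᗮ) :=
    (LinearIsometryEquiv.measurePreserving _).prod (MeasurePreserving.id _)
  have h2 := WithLp.volume_preserving_toLp (ℝ ∙ ν) (ℝ ∙ ν)ᗮ
  have h3 := (Submodule.orthogonalDecomposition (𝕜 := ℝ) (ℝ ∙ ν)).symm.measurePreserving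
  have h := ((h3.comp h2).comp h1).comp (Measure.measurePreserving_swap (μ := volume) (ν := volume))
  convert h using 2 with q
  · simp [add_comm]
  · rfl

omit [MeasurableSpace E] [BorelSpace E] in
lemma finrank_orthogonal_unit {ν : E} (hν : ‖ν‖ = 1) :
    Module.finrank ℝ (ℝ ∙ ν)ᗮ = Module.finrank ℝ E - 1 := by
  have h0 : ν ≠ 0 := by rintro rfl; simp at hν
  have := Submodule.finrank_add_finrank_orthogonal (𝕜 := ℝ) (ℝ ∙ ν)
  rw [finrank_span_singleton h0] at this
  omega

lemma volume_orthogonal_unit {ν : E} (hν : ‖ν‖ = 1) :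
    (volume : Measure (ℝ ∙ ν)ᗮ) = μHE[Module.finrank ℝ E - 1] := by
  rw [← finrank_orthogonal_unit hν, InnerProductSpace.euclideanHausdorffMeasure_eq_volume]

lemma euclideanHausdorffMeasure_image_le {X Y : Type*} [EMetricSpace X] [EMetricSpace Y]
    [MeasurableSpace X] [BorelSpace X] [MeasurableSpace Y] [BorelSpace Y] {K : ℝ≥0} {f : X → Y}
    (hf : LipschitzWith K f) (d : ℕ) (s : Set X) :
    μHE[d] (f '' s) ≤ (K : ℝ≥0∞) ^ d * μHE[d] s := by
  simp_rw [Measure.euclideanHausdorffMeasure_def, Measure.smul_apply]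
  have := hf.hausdorffMeasure_image_le (d := d) (by simp) s
  rw [ENNReal.rpow_natCast] at this
  rw [ENNReal.smul_def, ENNReal.smul_def, smul_eq_mul, smul_eq_mul, mul_left_comm]
  gcongr

/-- Projecting a graph orthogonally to its base hyperplane does not increase Hausdorff measure, so
an integral over the base is at most the integral over the graph. -/
lemma lintegral_graphOver_le {ν : E} (hν : ‖ν‖ = 1) {f : (ℝ ∙ ν)ᗮ → ℝ} (hf : Continuous f)
    {g : E → ℝ≥0∞} (hg : Measurable g) {S : Set E} (hS : MeasurableSet S)
    (hgS : ∀ y, graphOver ν f y ∉ S → g (graphOver ν f y) = 0) :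
    ∫⁻ y, g (graphOver ν f y) ≤ ∫⁻ x in S, g x ∂(μHE[Module.finrank ℝ E - 1]) := by
  have hΓ : Measurable (graphOver ν f) := by
    unfold graphOver
    exact (by fun_prop : Continuous fun y : (ℝ ∙ ν)ᗮ => (y : E) + f y • ν).measurable
  rw [← lintegral_map hg hΓ, ← lintegral_indicator hS]
  have hind : ∫⁻ x, g x ∂(volume.map (graphOver ν f)) =
      ∫⁻ x, S.indicator g x ∂(volume.map (graphOver ν f)) := by
    rw [lintegral_map hg hΓ, lintegral_map (hg.indicator hS) hΓ]
    congr with y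
    by_cases hy : graphOver ν f y ∈ S
    · rw [indicator_of_mem hy]
    · rw [indicator_of_notMem hy, hgS y hy]
  rw [hind]
  refine lintegral_mono' ?_ le_rfl
  refine Measure.le_iff.2 fun s hs => ?_
  rw [Measure.map_apply hΓ hs, volume_orthogonal_unit hν]
  have hP : LipschitzWith 1 ((ℝ ∙ ν)ᗮ.orthogonalProjectionOnto) :=
    Submodule.lipschitzWith_orthogonalProjectionOnto _
  have := euclideanHausdorffMeasure_image_le hP (Module.finrank ℝ E - 1) s
  rw [ENNReal.coe_one, one_pow, one_mul] at this
  refine (measure_mono fun y hy => ?_).trans this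
  exact ⟨_, hy, projection_add_smul _ _ _⟩

lemma euclideanHausdorffMeasure_graph_lt_top {ν : E} (hν : ‖ν‖ = 1) {f : (ℝ ∙ ν)ᗮ → ℝ} {η : ℝ≥0}
    (hf : LipschitzWith η f) {S : Set E} (hS : Bornology.IsBounded S)
    (hSf : ∀ x ∈ S, depth ν f x = 0) :
    μHE[Module.finrank ℝ E - 1] S < ⊤ := by
  set P := (ℝ ∙ ν)ᗮ.orthogonalProjectionOnto
  have hb : Bornology.IsBounded (P '' S) :=
    (Submodule.lipschitzWith_orthogonalProjectionOnto (ℝ ∙ ν)ᗮ).isBounded_image hS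
  have hsub : S ⊆ graphOver ν f '' (P '' S) := fun x hx =>
    ⟨P x, mem_image_of_mem _ hx, graphOver_projection hν f (hSf x hx)⟩
  refine (measure_mono hsub).trans_lt
    ((euclideanHausdorffMeasure_image_le (lipschitzWith_graphOver hν hf) _ _).trans_lt ?_)
  rw [← volume_orthogonal_unit hν]
  exact ENNReal.mul_lt_top (ENNReal.pow_lt_top ENNReal.coe_lt_top) hb.measure_lt_top

/-- The integral of a continuous function over a thin layer below a graph, divided by the
thickness of the layer, is asymptotically at most the integral of the function over the base. -/
lemma exists_layer_lintegral_le {ν : E} (hν : ‖ν‖ = 1) {f : (ℝ ∙ ν)ᗮ → ℝ} (hf : Continuous f)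
    {F : Type*} [NormedAddCommGroup F] {g : E → F} (hg : Continuous g) (hgc : HasCompactSupport g)
    {τ : ℝ≥0∞} (hτ : τ ≠ 0) :
    ∃ δ : ℝ, 0 < δ ∧ ∀ ε, 0 < ε → ε < δ →
      ∫⁻ x in {x | depth ν f x ∈ Icc 0 ε}, ‖g x‖ₑ ≤
        ENNReal.ofReal ε * ((∫⁻ y, ‖g (graphOver ν f y)‖ₑ) + τ) := by
  have hdm : Measurable (depth ν f) := by
    unfold depth
    exact (by fun_prop : Continuous fun x : E =>
      f ((ℝ ∙ ν)ᗮ.orthogonalProjectionOnto x) - inner ℝ ν x).measurable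
  set P := (ℝ ∙ ν)ᗮ.orthogonalProjectionOnto with hP
  set K : Set (ℝ ∙ ν)ᗮ := P '' tsupport g with hK
  have hKc : IsCompact K := hgc.isCompact.image P.continuous
  -- `K` is the shadow of the support of `g`; an oscillation of `g` by `σ` along the lines over `K`
  -- costs at most `τ`.
  obtain ⟨σ, hσ, hστ⟩ : ∃ σ : ℝ≥0, 0 < σ ∧ σ * volume K ≤ τ := by
    rcases eq_or_ne (volume K) 0 with h | h
    · exact ⟨1, one_pos, by simp [h]⟩
    · obtain ⟨σ, hσ, h1⟩ :=
        ENNReal.exists_nnreal_pos_mul_lt (hKc.measure_lt_top (μ := volume)).ne hτ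
      exact ⟨σ, hσ, h1.le⟩
  obtain ⟨δ, hδ, hδg⟩ := Metric.uniformContinuous_iff.1
    (hgc.uniformContinuous_of_continuous hg) σ hσ
  refine ⟨δ, hδ, fun ε hε hεδ => ?_⟩
  have hlayer : MeasurableSet {x | depth ν f x ∈ Icc 0 ε} := hdm measurableSet_Icc
  have hpt : ∀ (y : (ℝ ∙ ν)ᗮ) (t : ℝ),
      ({x | depth ν f x ∈ Icc 0 ε}.indicator (fun x => ‖g x‖ₑ)) ((y : E) + t • ν) ≤
        (Icc (f y - ε) (f y)).indicator
          (fun _ => ‖g (graphOver ν f y)‖ₑ + K.indicator (fun _ => (σ : ℝ≥0∞)) y) t := by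
    intro y t
    by_cases ht : t ∈ Icc (f y - ε) (f y)
    · rw [indicator_of_mem ht]
      refine (indicator_le_self' (by simp) _).trans ?_
      by_cases hy : y ∈ K
      · rw [indicator_of_mem hy]
        have hd : dist ((y : E) + t • ν) (graphOver ν f y) < δ := by
          rw [graphOver, dist_add_left, dist_eq_norm, ← sub_smul, norm_smul, hν, mul_one,
            Real.norm_eq_abs, abs_lt]
          constructor <;> linarith [ht.1, ht.2]
        have h1 := hδg hd
        have h2 : ‖g ((y : E) + t • ν) - g (graphOver ν f y)‖ₑ ≤ σ := by
          rw [dist_eq_norm] at h1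
          rw [enorm_eq_nnnorm]
          exact_mod_cast h1.le
        calc ‖g ((y : E) + t • ν)‖ₑ
            = ‖g (graphOver ν f y) + (g ((y : E) + t • ν) - g (graphOver ν f y))‖ₑ := by
              rw [add_sub_cancel]
          _ ≤ _ := (enorm_add_le _ _).trans (by gcongr)
      · have : g ((y : E) + t • ν) = 0 := by
          by_contra h
          exact hy ⟨_, subset_tsupport _ h, projection_add_smul _ _ _⟩
        simp [this]
    · rw [indicator_of_notMem, indicator_of_notMem ht]
      rintro ⟨h1, h2⟩
      rw [depth_add_smul hν] at h1 h2
      exact ht ⟨by linarith, by linarith⟩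
  have hm : Measurable ({x | depth ν f x ∈ Icc 0 ε}.indicator fun x => ‖g x‖ₑ) :=
    hg.enorm.measurable.indicator hlayer
  rw [← lintegral_indicator hlayer, ← (measurePreserving_add_smul hν).lintegral_comp hm,
    Measure.volume_eq_prod, 
    lintegral_prod (μ := volume) (ν := volume)
      (fun q : (ℝ ∙ ν)ᗮ × ℝ =>
        {x | depth ν f x ∈ Icc 0 ε}.indicator (fun x => ‖g x‖ₑ) ((q.1 : E) + q.2 • ν))
      (hm.comp (measurePreserving_add_smul hν).measurable).aemeasurable]
  calc _ ≤ ∫⁻ y, ENNReal.ofReal ε *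
        (‖g (graphOver ν f y)‖ₑ + K.indicator (fun _ => (σ : ℝ≥0∞)) y) := by
        refine lintegral_mono fun y => (lintegral_mono fun t => hpt y t).trans_eq ?_
        rw [lintegral_indicator_const measurableSet_Icc, Real.volume_Icc, sub_sub_cancel, mul_comm]
    _ = ENNReal.ofReal ε * ((∫⁻ y, ‖g (graphOver ν f y)‖ₑ) + σ * volume K) := by
        rw [lintegral_const_mul' _ _ ENNReal.ofReal_ne_top, lintegral_add_right _
          (measurable_const.indicator hKc.measurableSet),
          lintegral_indicator_const hKc.measurableSet]
    _ ≤ _ := by gcongr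

end GraphMeasure

/-! ### The divergence and regions below a graph -/

section Divergence

variable {n : ℕ}

/-- The divergence of a vector field on `ℝⁿ`. -/
noncomputable def divergence (Y : EuclideanSpace ℝ (Fin n) → EuclideanSpace ℝ (Fin n))
    (x : EuclideanSpace ℝ (Fin n)) : ℝ :=
  ∑ i, (fderiv ℝ Y x (stdVec i)) i

variable {Y : EuclideanSpace ℝ (Fin n) → EuclideanSpace ℝ (Fin n)}

lemma sum_smul_stdVec (x : EuclideanSpace ℝ (Fin n)) : ∑ i, x i • (stdVec i) = x := by
  ext j
  simp [stdVec, Pi.single_apply]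

lemma continuous_divergence (hY : ContDiff ℝ 1 Y) : Continuous (divergence Y) := by
  have := hY.continuous_fderiv one_ne_zero
  unfold divergence
  fun_prop

lemma divergence_eq_zero_of_notMem_tsupport {x : EuclideanSpace ℝ (Fin n)} (hx : x ∉ tsupport Y) :
    divergence Y x = 0 := by
  have : fderiv ℝ Y x = 0 := by
    by_contra h
    exact hx (support_fderiv_subset ℝ h)
  simp [divergence, this]

lemma hasCompactSupport_divergence (hYc : HasCompactSupport Y) :
    HasCompactSupport (divergence Y) :=
  hYc.mono' fun x hx => by
    by_contra h
    exact hx (divergence_eq_zero_of_notMem_tsupport h)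

/-- Integration by parts against a Lipschitz function, which is differentiable almost everywhere
by Rademacher's theorem. -/
lemma integral_mul_divergence {χ : EuclideanSpace ℝ (Fin n) → ℝ} {C : ℝ≥0}
    (hχ : LipschitzWith C χ) (hY : ContDiff ℝ 1 Y) (hYc : HasCompactSupport Y) :
    ∫ x, χ x * divergence Y x = -∫ x, fderiv ℝ χ x (Y x) := by
  have hdiff : ∀ i : Fin n, ContDiff ℝ 1 fun x => Y x i := fun i => by fun_prop
  have hsupp : ∀ i : Fin n, HasCompactSupport fun x => Y x i := fun i =>
    hYc.comp_left (g := fun v : EuclideanSpace ℝ (Fin n) => v i) rfl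
  have hcd : ∀ i : Fin n, Continuous fun x => fderiv ℝ Y x (stdVec i) i := fun i => by
    have := hY.continuous_fderiv one_ne_zero
    fun_prop
  have hline : ∀ (i : Fin n) x, lineDeriv ℝ (fun x => Y x i) x (-stdVec i) =
      -(fderiv ℝ Y x (stdVec i) i) := fun i x => by
    have hYx : DifferentiableAt ℝ Y x := hY.differentiable one_ne_zero x
    have h2 : HasFDerivAt (fun x => Y x i)
        ((EuclideanSpace.proj i : EuclideanSpace ℝ (Fin n) →L[ℝ] ℝ).comp (fderiv ℝ Y x)) x :=
      (EuclideanSpace.proj i : EuclideanSpace ℝ (Fin n) →L[ℝ] ℝ).hasFDerivAt.comp x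
        hYx.hasFDerivAt
    rw [h2.differentiableAt.lineDeriv_eq_fderiv, h2.fderiv]
    simp
  have hparts : ∀ i : Fin n, ∫ x, χ x * (fderiv ℝ Y x (stdVec i) i) =
      -∫ x, lineDeriv ℝ χ x (stdVec i) * Y x i := fun i => by
    obtain ⟨C', hC'⟩ := (hdiff i).lipschitzWith_of_hasCompactSupport (hsupp i) one_ne_zero
    rw [hχ.integral_lineDeriv_mul_eq hC' (hsupp i), ← integral_neg]
    congr with x
    rw [hline]; ring
  have hint1 : ∀ i ∈ Finset.univ, Integrable fun x => χ x * (fderiv ℝ Y x (stdVec i) i) :=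
    fun i _ => by
      refine (hχ.continuous.mul (hcd i)).integrable_of_hasCompactSupport ?_
      refine (hYc.mono' ?_ : HasCompactSupport fun x => fderiv ℝ Y x (stdVec i) i).mul_left
      intro x hx
      refine support_fderiv_subset ℝ (f := Y) fun h => hx ?_
      simp [h]
  have hint2 : ∀ i ∈ Finset.univ, Integrable fun x => lineDeriv ℝ χ x (stdVec i) * Y x i :=
    fun i _ => ((hdiff i).continuous.integrable_of_hasCompactSupport (hsupp i)).bdd_mul
      (aestronglyMeasurable_lineDeriv hχ.continuous _)
      (.of_forall fun x => norm_lineDeriv_le_of_lipschitz ℝ hχ)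
  simp_rw [divergence, Finset.mul_sum]
  rw [integral_finsetSum _ hint1, Finset.sum_congr rfl fun i _ => hparts i,
    Finset.sum_neg_distrib, ← integral_finsetSum _ hint2]
  congr 1
  refine integral_congr_ae ?_
  filter_upwards [hχ.ae_differentiableAt] with x hx
  conv_rhs => rw [← sum_smul_stdVec (Y x), map_sum]
  refine Finset.sum_congr rfl fun i _ => ?_
  rw [hx.lineDeriv_eq_fderiv, map_smul, smul_eq_mul, mul_comm]

lemma integral_divergence_eq_zero (hY : ContDiff ℝ 1 Y) (hYc : HasCompactSupport Y) :
    ∫ x, divergence Y x = 0 := by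
  simpa using integral_mul_divergence (LipschitzWith.const (1 : ℝ)) hY hYc

/-- The flux through a graph of small slope bounds the integral of the divergence over the region
below the graph. The indicator function of the region is replaced by a cut-off depending on the
depth only, whose gradient is at most `(1 + η) / ε` and lives in a layer of thickness `ε`. -/
lemma integral_divergence_depth_le {ν : EuclideanSpace ℝ (Fin n)} (hν : ‖ν‖ = 1)
    {f : (ℝ ∙ ν)ᗮ → ℝ} {η : ℝ≥0} (hf : LipschitzWith η f)
    (hY : ContDiff ℝ 1 Y) (hYc : HasCompactSupport Y) :
    ENNReal.ofReal (∫ x in {x | 0 < depth ν f x}, divergence Y x) ≤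
      (1 + η : ℝ≥0) * ∫⁻ y, ‖Y (graphOver ν f y)‖ₑ := by
  have hGL := lipschitzWith_depth hν hf
  set G := depth ν f with hG
  set χ : ℝ → EuclideanSpace ℝ (Fin n) → ℝ := fun ε x => max 0 (min 1 (ε⁻¹ • G x)) with hχ
  have hχL : ∀ ε, LipschitzWith (‖ε⁻¹‖₊ * (1 + η)) (χ ε) := fun ε =>
    (((lipschitzWith_smul ε⁻¹).comp hGL).const_min 1).const_max 0
  have hχ1 : ∀ ε x, ‖χ ε x‖ ≤ 1 := fun ε x => by
    rw [Real.norm_eq_abs, abs_of_nonneg (le_max_left _ _)]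
    exact max_le zero_le_one (min_le_left _ _)
  have hχ_above : ∀ ε, 0 < ε → ∀ z, G z ≤ 0 → χ ε z = 0 := fun ε hε z hz =>
    max_eq_left ((min_le_right _ _).trans
      (mul_nonpos_of_nonneg_of_nonpos (inv_nonneg.2 hε.le) hz))
  have hχ_below : ∀ ε, 0 < ε → ∀ z, ε < G z → χ ε z = 1 := fun ε hε z hz => by
    have : 1 ≤ ε⁻¹ • G z := by
      rw [smul_eq_mul, ← div_eq_inv_mul, one_le_div hε]
      exact hz.le
    simp only [hχ, min_eq_left this, max_eq_right zero_le_one]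
  have hfd : ∀ ε, 0 < ε → ∀ x, ‖fderiv ℝ (χ ε) x (Y x)‖ₑ ≤
      {x | G x ∈ Icc 0 ε}.indicator
        (fun x => (‖ε⁻¹‖₊ * (1 + η) : ℝ≥0) * ‖Y x‖ₑ) x := by
    intro ε hε x
    have hzero : ∀ c : ℝ, (χ ε =ᶠ[𝓝 x] fun _ => c) → fderiv ℝ (χ ε) x (Y x) = 0 := fun c h => by
      rw [h.fderiv_eq]; simp
    by_cases hx : G x ∈ Icc 0 ε
    · rw [indicator_of_mem (show x ∈ {x | G x ∈ Icc 0 ε} from hx)]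
      have h1 := (fderiv ℝ (χ ε) x).le_opNorm (Y x)
      have h2 := norm_fderiv_le_of_lipschitz ℝ (x₀ := x) (hχL ε)
      rw [enorm_eq_nnnorm, enorm_eq_nnnorm, ← ENNReal.coe_mul, ENNReal.coe_le_coe,
        ← NNReal.coe_le_coe]
      exact h1.trans (mul_le_mul_of_nonneg_right h2 (norm_nonneg _))
    · rw [indicator_of_notMem (show x ∉ {x | G x ∈ Icc 0 ε} from hx), nonpos_iff_eq_zero,
        enorm_eq_zero]
      rw [mem_Icc, not_and_or, not_le, not_le] at hx
      rcases hx with hx | hx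
      · refine hzero 0 ?_
        filter_upwards [hGL.continuous.continuousAt.eventually (gt_mem_nhds hx)] with z hz
        exact hχ_above ε hε z hz.le
      · refine hzero 1 ?_
        filter_upwards [hGL.continuous.continuousAt.eventually (lt_mem_nhds hx)] with z hz
        exact hχ_below ε hε z hz
  have hlayer : ∀ ε, MeasurableSet {x | G x ∈ Icc 0 ε} := fun ε =>
    hGL.continuous.measurable measurableSet_Icc
  refine ENNReal.le_of_forall_pos_le_add fun τ hτ _ => ?_
  obtain ⟨τ', hτ', hττ'⟩ : ∃ τ' : ℝ≥0, 0 < τ' ∧ (1 + η) * τ' ≤ τ :=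
    ⟨τ / (1 + η), by positivity, by rw [mul_div_cancel₀ _ (by positivity)]⟩
  obtain ⟨δ, hδ, hδε⟩ := exists_layer_lintegral_le hν hf.continuous hY.continuous hYc
    (τ := τ') (by exact_mod_cast hτ'.ne')
  have hle : ∀ ε, 0 < ε → ε < δ → ENNReal.ofReal (∫ x, χ ε x * divergence Y x) ≤
      (1 + η : ℝ≥0) * (∫⁻ y, ‖Y (graphOver ν f y)‖ₑ) + τ := by
    intro ε hε hεδ
    rw [integral_mul_divergence (hχL ε) hY hYc, ← integral_neg]
    calc ENNReal.ofReal (∫ x, -fderiv ℝ (χ ε) x (Y x))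
        ≤ ‖∫ x, -fderiv ℝ (χ ε) x (Y x)‖ₑ := by
          rw [← ofReal_norm]
          exact ENNReal.ofReal_le_ofReal (le_abs_self _)
      _ ≤ ∫⁻ x, ‖-fderiv ℝ (χ ε) x (Y x)‖ₑ := enorm_integral_le_lintegral_enorm _
      _ ≤ ∫⁻ x in {x | G x ∈ Icc 0 ε}, (‖ε⁻¹‖₊ * (1 + η) : ℝ≥0) * ‖Y x‖ₑ := by
          rw [← lintegral_indicator (hlayer ε)]
          exact lintegral_mono fun x => by rw [enorm_neg]; exact hfd ε hε x
      _ = (‖ε⁻¹‖₊ * (1 + η) : ℝ≥0) * ∫⁻ x in {x | G x ∈ Icc 0 ε}, ‖Y x‖ₑ :=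
          lintegral_const_mul' _ _ ENNReal.coe_ne_top
      _ ≤ (‖ε⁻¹‖₊ * (1 + η) : ℝ≥0) *
            (ENNReal.ofReal ε * ((∫⁻ y, ‖Y (graphOver ν f y)‖ₑ) + τ')) := by
          gcongr
          exact hδε ε hε hεδ
      _ = (1 + η : ℝ≥0) * ((∫⁻ y, ‖Y (graphOver ν f y)‖ₑ) + τ') := by
          rw [← mul_assoc]
          congr 1
          rw [ENNReal.ofReal, ← ENNReal.coe_mul, mul_right_comm]
          congr 1
          rw [← NNReal.coe_inj]
          push_cast
          rw [Real.coe_toNNReal _ hε.le, Real.norm_eq_abs, abs_of_pos (inv_pos.2 hε),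
            inv_mul_cancel₀ hε.ne', one_mul]
      _ ≤ _ := by
          rw [mul_add]
          gcongr
          exact_mod_cast hττ'
  -- The cut-offs converge pointwise to the indicator function of the region `{0 < G}`.
  have hpos : MeasurableSet {x | 0 < G x} := hGL.continuous.measurable measurableSet_Ioi
  have hlim : Tendsto (fun k : ℕ => ∫ x, χ (1 / ((k : ℝ) + 1)) x * divergence Y x) atTop
      (𝓝 (∫ x in {x | 0 < G x}, divergence Y x)) := by
    rw [← integral_indicator hpos]
    refine tendsto_integral_of_dominated_convergence (fun x => ‖divergence Y x‖) (fun k => ?_) ?_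
      (fun k => .of_forall fun x => ?_) (.of_forall fun x => ?_)
    · exact ((hχL _).continuous.mul (continuous_divergence hY)).aestronglyMeasurable
    · exact ((continuous_divergence hY).integrable_of_hasCompactSupport
        (hasCompactSupport_divergence hYc)).norm
    · rw [norm_mul]
      exact mul_le_of_le_one_left (norm_nonneg _) (hχ1 _ _)
    · by_cases hx : 0 < G x
      · rw [indicator_of_mem (show x ∈ {x | 0 < G x} from hx)]
        refine tendsto_const_nhds.congr' ?_
        filter_upwards [tendsto_one_div_add_atTop_nhds_zero_nat.eventually (gt_mem_nhds hx)]
          with k hk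
        rw [hχ_below _ (by positivity) x hk, one_mul]
      · rw [indicator_of_notMem (show x ∉ {x | 0 < G x} from hx)]
        refine tendsto_const_nhds.congr fun k => ?_
        rw [hχ_above _ (by positivity) x (not_lt.1 hx), zero_mul]
  refine le_of_tendsto ((ENNReal.continuous_ofReal.tendsto _).comp hlim) ?_
  filter_upwards [tendsto_one_div_add_atTop_nhds_zero_nat.eventually (gt_mem_nhds hδ)] with k hk
  exact hle _ (by positivity) hk

end Divergence

/-! ### Domains with smooth boundary -/

section Flux

variable {n : ℕ} {D : Set (EuclideanSpace ℝ (Fin n))}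

/-- Near a boundary point the domain is the region below the graph of a function of small
slope. -/
lemma HasSmoothBoundary.exists_depth (hDo : IsOpen D) (hD : HasSmoothBoundary D)
    {p : EuclideanSpace ℝ (Fin n)} (hp : p ∈ frontier D) {η : ℝ≥0} (hη : 0 < η) :
    ∃ (ν : EuclideanSpace ℝ (Fin n)) (f : (ℝ ∙ ν)ᗮ → ℝ) (U : Set (EuclideanSpace ℝ (Fin n))),
      ‖ν‖ = 1 ∧ LipschitzWith η f ∧ IsOpen U ∧ p ∈ U ∧ ∀ x ∈ U, x ∈ D ↔ 0 < depth ν f x := by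
  obtain ⟨U, ρ, hU, hpU, hρ, hdρ, hDU⟩ := hD p hp
  have hmem : ∀ x ∈ U, x ∈ D ↔ ρ x < 0 := fun x hx => by
    have : x ∈ D ∩ U ↔ x ∈ {x ∈ U | ρ x < 0} := by rw [hDU]
    simpa [hx] using this
  have hcd : ContDiffAt ℝ ∞ ρ p := hρ.contDiffAt (hU.mem_nhds hpU)
  have hp0 : ρ p = 0 := by
    refine le_antisymm ?_ (not_lt.1 fun h => ?_)
    · have hcl : p ∈ closure (D ∩ U) := by
        rw [inter_comm]
        exact hU.inter_closure ⟨hpU, hp.1⟩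
      have h1 : ∃ᶠ x in 𝓝 p, x ∈ D ∩ U := mem_closure_iff_frequently.1 hcl
      by_contra! h
      exact h1 ((hcd.continuousAt.eventually (lt_mem_nhds h)).mono fun x hx hxD =>
        absurd ((hmem x hxD.2).1 hxD.1) (not_lt.2 (le_of_lt hx)))
    · exact hp.2 (by rw [hDo.interior_eq]; exact (hmem p hpU).2 h)
  obtain ⟨ν, f, V, hν, hf, hV, hpV, hVρ⟩ := exists_sublevel_eq_depth_pos
    (hcd.hasStrictFDerivAt (by simp))
    ((hU.eventually_mem hpU).mono fun x hx => hρ.continuousOn.continuousAt (hU.mem_nhds hx))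
    hp0 hdρ hη
  exact ⟨ν, f, U ∩ V, hν, hf, hU.inter hV, ⟨hpU, hpV⟩, fun x hx =>
    (hmem x hx.1).trans (hVρ x hx.2)⟩

lemma mem_frontier_iff_depth_eq_zero (hDo : IsOpen D) {ν : EuclideanSpace ℝ (Fin n)}
    (hν : ‖ν‖ = 1) {f : (ℝ ∙ ν)ᗮ → ℝ} (hf : Continuous (depth ν f))
    {U : Set (EuclideanSpace ℝ (Fin n))} (hU : IsOpen U)
    (hDU : ∀ x ∈ U, x ∈ D ↔ 0 < depth ν f x) {x : EuclideanSpace ℝ (Fin n)} (hx : x ∈ U) :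
    x ∈ frontier D ↔ depth ν f x = 0 := by
  constructor
  · intro h
    refine le_antisymm (not_lt.1 fun h' => ?_) (not_lt.1 fun h' => ?_)
    · exact h.2 (by rw [hDo.interior_eq]; exact (hDU x hx).2 h')
    · have h1 : ∃ᶠ z in 𝓝 x, z ∈ D := mem_closure_iff_frequently.1 h.1
      refine h1 ?_
      filter_upwards [hU.eventually_mem hx, hf.continuousAt.eventually (gt_mem_nhds h')]
        with z hz hz' hzD
      exact absurd ((hDU z hz).1 hzD) (not_lt.2 (le_of_lt hz'))
  · intro h
    refine ⟨?_, fun h' => ?_⟩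
    · have hlim : Tendsto (fun s : ℝ => x - s • ν) (𝓝[>] 0) (𝓝 x) := by
        have : Continuous fun s : ℝ => x - s • ν := by fun_prop
        simpa using (this.tendsto 0).mono_left nhdsWithin_le_nhds
      refine mem_closure_of_tendsto hlim ?_
      filter_upwards [hlim.eventually (hU.eventually_mem hx), self_mem_nhdsWithin] with s hs hs0
      rw [hDU _ hs, depth_sub_smul hν, h, zero_add]
      exact hs0
    · rw [hDo.interior_eq, hDU x hx, h] at h'
      exact lt_irrefl _ h'

/-- Near a boundary point, the area of the boundary is finite and the flux of a vector field
through the boundary bounds the integral of the divergence, up to a factor as close to one as one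
likes. -/
lemma HasSmoothBoundary.exists_local_flux_le (hDo : IsOpen D) (hD : HasSmoothBoundary D)
    {p : EuclideanSpace ℝ (Fin n)} (hp : p ∈ frontier D) {η : ℝ≥0} (hη : 0 < η) :
    ∃ U : Set (EuclideanSpace ℝ (Fin n)), IsOpen U ∧ p ∈ U ∧ Bornology.IsBounded U ∧
      μHE[n - 1] (frontier D ∩ U) < ⊤ ∧
      ∀ Y : EuclideanSpace ℝ (Fin n) → EuclideanSpace ℝ (Fin n), ContDiff ℝ 1 Y →
        HasCompactSupport Y → tsupport Y ⊆ U →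
        ENNReal.ofReal (∫ x in D, divergence Y x) ≤
          (1 + η : ℝ≥0) * ∫⁻ x in frontier D, ‖Y x‖ₑ ∂μHE[n - 1] := by
  obtain ⟨ν, f, U, hν, hf, hU, hpU, hDU⟩ := hD.exists_depth hDo hp hη
  have hcont := (lipschitzWith_depth hν hf).continuous
  have hfr := @mem_frontier_iff_depth_eq_zero n D hDo ν hν f hcont U hU hDU
  have hbdd : Bornology.IsBounded (U ∩ Metric.ball p 1) :=
    Metric.isBounded_ball.subset inter_subset_right
  refine ⟨U ∩ Metric.ball p 1, hU.inter Metric.isOpen_ball,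
    ⟨hpU, Metric.mem_ball_self one_pos⟩, hbdd, ?_, fun Y hY hYc hYU => ?_⟩
  · have := euclideanHausdorffMeasure_graph_lt_top hν hf
      (hbdd.subset (inter_subset_right : frontier D ∩ (U ∩ Metric.ball p 1) ⊆ _))
      fun x hx => (hfr hx.2.1).1 hx.1
    rwa [finrank_euclideanSpace_fin] at this
  · have hYU' : ∀ x, x ∉ U → x ∉ tsupport Y := fun x hx h => hx (hYU h).1
    have hint : ∫ x in D, divergence Y x = ∫ x in {x | 0 < depth ν f x}, divergence Y x := by
      rw [← integral_indicator hDo.measurableSet,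
        ← integral_indicator (s := {x | 0 < depth ν f x}) (hcont.measurable measurableSet_Ioi)]
      congr with x
      by_cases hx : x ∈ U
      · simp only [indicator, hDU x hx, mem_ofPred_eq]
      · simp [indicator, divergence_eq_zero_of_notMem_tsupport (hYU' x hx)]
    rw [hint]
    refine (integral_divergence_depth_le hν hf hY hYc).trans ?_
    gcongr
    have := lintegral_graphOver_le hν hf.continuous (g := fun x => ‖Y x‖ₑ)
      hY.continuous.enorm.measurable (isClosed_frontier (s := D)).measurableSet fun y hy => ?_
    · rwa [finrank_euclideanSpace_fin] at this
    · by_cases hyU : graphOver ν f y ∈ U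
      · exact absurd ((hfr hyU).2 (depth_graphOver hν f y)) hy
      · rw [image_eq_zero_of_notMem_tsupport (hYU' _ hyU), enorm_zero]

lemma HasSmoothBoundary.area_lt_top (hDo : IsOpen D) (hDc : IsCompact (closure D))
    (hD : HasSmoothBoundary D) : μHE[n - 1] (frontier D) < ⊤ := by
  refine (hDc.of_isClosed_subset isClosed_frontier
    frontier_subset_closure).measure_lt_top_of_nhdsWithin fun p hp => ?_
  obtain ⟨U, hU, hpU, -, hlt, -⟩ := hD.exists_local_flux_le hDo hp one_pos
  exact ⟨frontier D ∩ U, inter_mem_nhdsWithin _ (hU.mem_nhds hpU), hlt⟩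

lemma HasSmoothBoundary.volume_frontier (hn : 1 ≤ n) (hDo : IsOpen D) (hDc : IsCompact (closure D))
    (hD : HasSmoothBoundary D) : volume (frontier D) = 0 := by
  rw [← EuclideanSpace.euclideanHausdorffMeasure_eq_volume]
  exact (Measure.euclideanHausdorffMeasure_zero_or_top (by omega : n - 1 < n) _).resolve_right
    (hD.area_lt_top hDo hDc).ne

/-- The consequence of the divergence theorem used below: the total divergence of a vector field
is at most its maximal length times the area of the boundary. A partition of unity reduces the
claim to vector fields supported near one point, at the cost of a factor `1 + η` that tends to
one. -/
theorem HasSmoothBoundary.integral_divergence_le (hDo : IsOpen D) (hDc : IsCompact (closure D))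
    (hD : HasSmoothBoundary D) {Ω : Set (EuclideanSpace ℝ (Fin n))} (hΩ : IsOpen Ω)
    (hDΩ : closure D ⊆ Ω) {X : EuclideanSpace ℝ (Fin n) → EuclideanSpace ℝ (Fin n)}
    (hX : ContDiffOn ℝ 1 X Ω) {M : ℝ≥0} (hM : ∀ x ∈ closure D, ‖X x‖ ≤ M) :
    ENNReal.ofReal (∫ x in D, divergence X x) ≤ M * μHE[n - 1] (frontier D) := by
  have hfin := hD.area_lt_top hDo hDc
  suffices H : ∀ η : ℝ≥0, 0 < η → ENNReal.ofReal (∫ x in D, divergence X x) ≤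
      (1 + η : ℝ≥0) * (M * μHE[n - 1] (frontier D)) by
    have hlim : Tendsto (fun η : ℝ≥0 => ((1 + η : ℝ≥0) : ℝ≥0∞) * (M * μHE[n - 1] (frontier D)))
        (𝓝[>] 0) (𝓝 (M * μHE[n - 1] (frontier D))) := by
      have h1 : Continuous fun η : ℝ≥0 =>
          ((1 + η : ℝ≥0) : ℝ≥0∞) * (M * μHE[n - 1] (frontier D)) :=
        (ENNReal.continuous_mul_const (ENNReal.mul_lt_top ENNReal.coe_lt_top hfin).ne).comp
          (by fun_prop)
      simpa using (h1.tendsto 0).mono_left nhdsWithin_le_nhds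
    exact ge_of_tendsto hlim (eventually_mem_nhdsWithin.mono fun η hη => H η hη)
  intro η hη
  have hloc : ∀ p : closure D, ∃ U : Set (EuclideanSpace ℝ (Fin n)), IsOpen U ∧ p.1 ∈ U ∧
      Bornology.IsBounded U ∧
      ∀ Y : EuclideanSpace ℝ (Fin n) → EuclideanSpace ℝ (Fin n), ContDiff ℝ 1 Y →
        HasCompactSupport Y → tsupport Y ⊆ U →
        ENNReal.ofReal (∫ x in D, divergence Y x) ≤
          (1 + η : ℝ≥0) * ∫⁻ x in frontier D, ‖Y x‖ₑ ∂μHE[n - 1] := by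
    rintro ⟨p, hp⟩
    by_cases hpD : p ∈ D
    · refine ⟨D, hDo, hpD, hDc.isBounded.subset subset_closure, fun Y hY hYc hYD => ?_⟩
      rw [setIntegral_eq_integral_of_forall_compl_eq_zero fun x hx =>
        divergence_eq_zero_of_notMem_tsupport fun h => hx (hYD h),
        integral_divergence_eq_zero hY hYc]
      simp
    · have hpf : p ∈ frontier D := ⟨hp, by rwa [hDo.interior_eq]⟩
      obtain ⟨U, hU, hpU, hb, -, h⟩ := hD.exists_local_flux_le hDo hpf hη
      exact ⟨U, hU, hpU, hb, h⟩
  choose U hUo hpU hUb hU using hloc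
  obtain ⟨t, ht⟩ := hDc.elim_finite_subcover (fun p => U p ∩ Ω) (fun p => (hUo p).inter hΩ)
    fun p hp => mem_iUnion.2 ⟨⟨p, hp⟩, hpU ⟨p, hp⟩, hDΩ hp⟩
  obtain ⟨φ, hφ⟩ := SmoothPartitionOfUnity.exists_isSubordinate
    (modelWithCornersSelf ℝ (EuclideanSpace ℝ (Fin n))) isClosed_closure
    (fun p : t => U p ∩ Ω) (fun p => (hUo p).inter hΩ) (by rwa [iUnion_subtype])
  have hφc : ∀ i, ContDiff ℝ 1 (φ i) := fun i => (φ i).contMDiff.contDiff.of_le (by simp)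
  set Y : t → EuclideanSpace ℝ (Fin n) → EuclideanSpace ℝ (Fin n) := fun i x => φ i x • X x
  have hsum : ∀ x ∈ closure D, ∑ i, φ i x = 1 := fun x hx => by
    rw [← finsum_eq_sum_of_fintype]
    exact φ.sum_eq_one hx
  have hYsupp : ∀ i, tsupport (Y i) ⊆ tsupport (φ i) := fun i =>
    closure_mono fun x hx h => hx (by simp only [Y, h, zero_smul])
  have hYd : ∀ i, ContDiff ℝ 1 (Y i) := fun i => by
    rw [contDiff_iff_contDiffAt]
    intro x
    by_cases hx : x ∈ tsupport (φ i)
    · exact (hφc i).contDiffAt.smul (hX.contDiffAt (hΩ.mem_nhds (hφ i hx).2))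
    · have : Y i =ᶠ[𝓝 x] fun _ => 0 := by
        filter_upwards [(isClosed_tsupport (φ i)).isOpen_compl.mem_nhds hx] with z hz
        simp only [Y]
        rw [image_eq_zero_of_notMem_tsupport hz, zero_smul]
      exact contDiffAt_const.congr_of_eventuallyEq this
  have hYU : ∀ i, tsupport (Y i) ⊆ U i := fun i =>
    (hYsupp i).trans ((hφ i).trans inter_subset_left)
  have hYc : ∀ i, HasCompactSupport (Y i) := fun i =>
    Metric.isCompact_of_isClosed_isBounded (isClosed_tsupport _) ((hUb i).subset (hYU i))
  have hdiv : ∀ x ∈ D, divergence X x = ∑ i, divergence (Y i) x := fun x hx => by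
    have h1 : X =ᶠ[𝓝 x] fun z => ∑ i, Y i z := by
      filter_upwards [hDo.mem_nhds hx] with z hz
      simp only [Y]
      rw [← Finset.sum_smul, hsum z (subset_closure hz), one_smul]
    have h2 : fderiv ℝ X x = ∑ i, fderiv ℝ (Y i) x := by
      rw [h1.fderiv_eq, fderiv_fun_sum fun i _ => (hYd i).differentiable one_ne_zero x]
    simp only [divergence, h2]
    rw [Finset.sum_comm]
    simp
  rw [setIntegral_congr_fun hDo.measurableSet hdiv, integral_finsetSum _ fun i _ =>
    ((continuous_divergence (hYd i)).integrable_of_hasCompactSupport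
      (hasCompactSupport_divergence (hYc i))).integrableOn]
  calc ENNReal.ofReal (∑ i, ∫ x in D, divergence (Y i) x)
      ≤ ∑ i, ENNReal.ofReal (∫ x in D, divergence (Y i) x) :=
        Finset.le_sum_of_subadditive _ ENNReal.ofReal_zero.le (fun _ _ => ENNReal.ofReal_add_le) _ _
    _ ≤ ∑ i, (1 + η : ℝ≥0) * ∫⁻ x in frontier D, ‖Y i x‖ₑ ∂μHE[n - 1] :=
        Finset.sum_le_sum fun i _ => hU i (Y i) (hYd i) (hYc i) (hYU i)
    _ = (1 + η : ℝ≥0) * ∫⁻ x in frontier D, ∑ i, ‖Y i x‖ₑ ∂μHE[n - 1] := by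
        rw [← Finset.mul_sum, lintegral_finsetSum _ fun i _ =>
          (hYd i).continuous.enorm.measurable]
    _ ≤ (1 + η : ℝ≥0) * ∫⁻ x in frontier D, M ∂μHE[n - 1] := by
        refine mul_le_mul_right ?_ _
        refine setLIntegral_mono measurable_const fun x hx => ?_
        have hx' := frontier_subset_closure hx
        have h1 : ∀ i, ‖Y i x‖ₑ = ENNReal.ofReal (φ i x) * ‖X x‖ₑ := fun i => by
          rw [enorm_smul, Real.enorm_of_nonneg (φ.nonneg i x)]
        simp_rw [h1]
        rw [← Finset.sum_mul, ← ENNReal.ofReal_sum_of_nonneg fun i _ => φ.nonneg i x, hsum x hx',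
          ENNReal.ofReal_one, one_mul, enorm_eq_nnnorm, ENNReal.coe_le_coe]
        exact hM x hx'
    _ = _ := by rw [setLIntegral_const]

end Flux

/-! ### The mean curvature of a graph -/

section Curvature

variable {n : ℕ} {Ω : Set (EuclideanSpace ℝ (Fin n))} {ψ : EuclideanSpace ℝ (Fin n) → ℝ}
  {u : EuclideanSpace ℝ (Fin n)}

lemma inner_stdVec (v : EuclideanSpace ℝ (Fin n)) (i : Fin n) : inner ℝ v (stdVec i) = v i := by
  simp [stdVec, EuclideanSpace.inner_single_right]

lemma contDiffOn_gradient (hΩ : IsOpen Ω) (hψ : ContDiffOn ℝ 2 ψ Ω) :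
    ContDiffOn ℝ 1 (gradient ψ) Ω :=
  (InnerProductSpace.toDual ℝ _).symm.toContinuousLinearEquiv.toContinuousLinearMap.contDiff
    |>.comp_contDiffOn
    (hψ.fderiv_of_isOpen hΩ (by norm_num))

lemma fderiv_graphMap (h : DifferentiableAt ℝ ψ u) (v : EuclideanSpace ℝ (Fin n)) :
    fderiv ℝ (graphMap ψ) u v = (v, inner ℝ (gradient ψ u) v) := by
  have : HasFDerivAt (graphMap ψ) ((ContinuousLinearMap.id ℝ _).prod (fderiv ℝ ψ u)) u :=
    (hasFDerivAt_id u).prodMk h.hasFDerivAt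
  rw [this.fderiv]
  simp [inner_gradient_left]

lemma inducedMetric_eq (h : DifferentiableAt ℝ ψ u) (v w : EuclideanSpace ℝ (Fin n)) :
    inducedMetric ψ u v w =
      inner ℝ v w - inner ℝ (gradient ψ u) v * inner ℝ (gradient ψ u) w := by
  rw [inducedMetric, fderiv_graphMap h, fderiv_graphMap h, lorentz]
  simp [PiLp.inner_apply, mul_comm]

lemma IsSpaceLike.norm_gradient_lt_one (hs : IsSpaceLike ψ Ω) (hu : u ∈ Ω)
    (h : DifferentiableAt ℝ ψ u) : ‖gradient ψ u‖ < 1 := by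
  by_cases h0 : gradient ψ u = 0
  · simp [h0]
  have := hs u hu _ h0
  rw [inducedMetric_eq h, real_inner_self_eq_norm_sq] at this
  have h1 : 0 < ‖gradient ψ u‖ ^ 2 := by positivity
  have h2 : ‖gradient ψ u‖ ^ 2 < 1 := by nlinarith
  exact (sq_lt_one_iff₀ (norm_nonneg _)).1 h2

lemma IsTimeLike.one_lt_norm_gradient (ht : IsTimeLike ψ Ω) (hu : u ∈ Ω)
    (h : DifferentiableAt ℝ ψ u) : 1 < ‖gradient ψ u‖ := by
  obtain ⟨v, hv, -⟩ := ht u hu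
  rw [inducedMetric_eq h, real_inner_self_eq_norm_sq] at hv
  have h1 : inner ℝ (gradient ψ u) v * inner ℝ (gradient ψ u) v ≤ (‖gradient ψ u‖ * ‖v‖) ^ 2 := by
    rw [← sq]
    exact sq_le_sq' (by linarith [abs_le.1 (abs_real_inner_le_norm (gradient ψ u) v)])
      (real_inner_le_norm _ _)
  have h2 : 0 < ‖v‖ ^ 2 * (‖gradient ψ u‖ ^ 2 - 1) := by linarith [mul_pow ‖gradient ψ u‖ ‖v‖ 2]
  have h3 : 0 < ‖gradient ψ u‖ ^ 2 - 1 := pos_of_mul_pos_right h2 (by positivity)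
  exact (one_lt_sq_iff₀ (norm_nonneg _)).1 (by linarith)

lemma firstForm_eq (h : DifferentiableAt ℝ ψ u) :
    firstForm ψ u = 1 - Matrix.vecMulVec (gradient ψ u).ofLp (gradient ψ u).ofLp := by
  ext i j
  rw [firstForm, Matrix.of_apply, inducedMetric_eq h, inner_stdVec, inner_stdVec, inner_stdVec]
  simp [Matrix.vecMulVec_apply, Matrix.one_apply, stdVec, eq_comm]

/-- The Sherman–Morrison formula for the inverse of the first fundamental form. -/
lemma inv_firstForm (h : DifferentiableAt ℝ ψ u) (h1 : 1 - ‖gradient ψ u‖ ^ 2 ≠ 0) :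
    (firstForm ψ u)⁻¹ =
      1 + (1 - ‖gradient ψ u‖ ^ 2)⁻¹ •
        Matrix.vecMulVec (gradient ψ u).ofLp (gradient ψ u).ofLp := by
  apply Matrix.inv_eq_right_inv
  rw [firstForm_eq h]
  have hsq : Matrix.vecMulVec (gradient ψ u).ofLp (gradient ψ u).ofLp *
      Matrix.vecMulVec (gradient ψ u).ofLp (gradient ψ u).ofLp =
      ‖gradient ψ u‖ ^ 2 • Matrix.vecMulVec (gradient ψ u).ofLp (gradient ψ u).ofLp := by
    rw [Matrix.vecMulVec_mul_vecMulVec, EuclideanSpace.real_norm_sq_eq]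
    ext i j
    simp [Matrix.vecMulVec_apply, dotProduct, sq]
    ring
  rw [sub_mul, mul_add, mul_add, one_mul, one_mul, mul_one, Matrix.mul_smul, hsq, smul_smul]
  set A := Matrix.vecMulVec (gradient ψ u).ofLp (gradient ψ u).ofLp
  set s := ‖gradient ψ u‖ ^ 2
  have : A = (1 - s)⁻¹ • A - ((1 - s)⁻¹ * s) • A := by
    rw [← sub_smul, ← mul_one_sub, inv_mul_cancel₀ h1, one_smul]
  nth_rewrite 2 [this]
  abel

lemma secondForm_apply (hΩ : IsOpen Ω) (hψ : ContDiffOn ℝ 2 ψ Ω) (hu : u ∈ Ω) (i j : Fin n) :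
    secondForm ψ u i j =
      (√|1 - ‖gradient ψ u‖ ^ 2|)⁻¹ * (fderiv ℝ (gradient ψ) u (stdVec i)) j := by
  have hd : ∀ v ∈ Ω, DifferentiableAt ℝ ψ v := fun v hv =>
    (hψ.differentiableOn two_ne_zero).differentiableAt (hΩ.mem_nhds hv)
  have hg : DifferentiableAt ℝ (gradient ψ) u :=
    ((contDiffOn_gradient hΩ hψ).differentiableOn one_ne_zero).differentiableAt (hΩ.mem_nhds hu)
  have h1 : (fun v => fderiv ℝ (graphMap ψ) v (stdVec j)) =ᶠ[𝓝 u]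
      fun v => ((stdVec j : EuclideanSpace ℝ (Fin n)), gradient ψ v j) := by
    filter_upwards [hΩ.mem_nhds hu] with v hv
    rw [fderiv_graphMap (hd v hv), inner_stdVec]
  have h2 : HasFDerivAt (fun v => gradient ψ v j)
      ((EuclideanSpace.proj j : EuclideanSpace ℝ (Fin n) →L[ℝ] ℝ).comp
        (fderiv ℝ (gradient ψ) u)) u :=
    (EuclideanSpace.proj j : EuclideanSpace ℝ (Fin n) →L[ℝ] ℝ).hasFDerivAt.comp u hg.hasFDerivAt
  have h3 := (hasFDerivAt_const (stdVec j : EuclideanSpace ℝ (Fin n)) u).prodMk h2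
  rw [secondForm, Matrix.of_apply, h1.fderiv_eq, h3.fderiv, unitNormal, lorentz]
  simp [mul_comm]

/-- The vector field `∇ψ / √|1 - |∇ψ|²|`, whose divergence is `n` times the mean curvature. -/
noncomputable def normalizedGradient (ψ : EuclideanSpace ℝ (Fin n) → ℝ)
    (u : EuclideanSpace ℝ (Fin n)) : EuclideanSpace ℝ (Fin n) :=
  (√|1 - ‖gradient ψ u‖ ^ 2|)⁻¹ • gradient ψ u

lemma norm_normalizedGradient :
    ‖normalizedGradient ψ u‖ = ‖gradient ψ u‖ / √|1 - ‖gradient ψ u‖ ^ 2| := by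
  rw [normalizedGradient, norm_smul, norm_inv, Real.norm_eq_abs, abs_of_nonneg (Real.sqrt_nonneg _),
    div_eq_inv_mul]

/-- One formula for the derivative of `|t|^(-1/2)`, valid for both signs of `t`. -/
lemma hasDerivAt_inv_sqrt_abs {t : ℝ} (ht : t ≠ 0) :
    HasDerivAt (fun t => (√|t|)⁻¹) (-(1 / 2) * ((√|t|)⁻¹ * t⁻¹)) t := by
  have hpos : 0 < |t| := abs_pos.2 ht
  have h : HasDerivAt (fun t => (√|t|)⁻¹) _ t :=
    ((hasDerivAt_abs ht).sqrt hpos.ne').inv (Real.sqrt_ne_zero'.2 hpos)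
  refine h.congr_deriv ?_
  rw [Real.sq_sqrt hpos.le]
  have h2 : √|t| ≠ 0 := Real.sqrt_ne_zero'.2 hpos
  rcases lt_or_gt_of_ne ht with h | h
  · rw [sign_neg h, abs_of_neg h] at *
    field_simp
    simp
  · rw [sign_pos h, abs_of_pos h] at *
    field_simp
    simp

lemma contDiffOn_normalizedGradient (hΩ : IsOpen Ω) (hψ : ContDiffOn ℝ 2 ψ Ω)
    (h1 : ∀ u ∈ Ω, 1 - ‖gradient ψ u‖ ^ 2 ≠ 0) : ContDiffOn ℝ 1 (normalizedGradient ψ) Ω := by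
  have hg := contDiffOn_gradient hΩ hψ
  have hs : ContDiffOn ℝ 1 (fun u => 1 - ‖gradient ψ u‖ ^ 2) Ω :=
    contDiffOn_const.sub (hg.norm_sq ℝ)
  have hW : ContDiffOn ℝ 1 (fun u => (√|1 - ‖gradient ψ u‖ ^ 2|)⁻¹) Ω := fun u hu => ?_
  · exact hW.smul hg
  have hpos := abs_pos.2 (h1 u hu)
  have ha : ContDiffWithinAt ℝ 1 (fun u => |1 - ‖gradient ψ u‖ ^ 2|) Ω u :=
    ContDiffAt.comp_contDiffWithinAt (g := fun t : ℝ => |t|) u (contDiffAt_abs (h1 u hu)) (hs u hu)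
  exact (ha.sqrt hpos.ne').inv
    (Real.sqrt_ne_zero'.2 hpos)

lemma meanCurvature_eq_divergence (hΩ : IsOpen Ω) (hψ : ContDiffOn ℝ 2 ψ Ω) (hu : u ∈ Ω)
    (h1 : 1 - ‖gradient ψ u‖ ^ 2 ≠ 0) :
    meanCurvature ψ u = (1 / (n : ℝ)) * divergence (normalizedGradient ψ) u := by
  have hd : DifferentiableAt ℝ ψ u :=
    (hψ.differentiableOn two_ne_zero).differentiableAt (hΩ.mem_nhds hu)
  have hg : DifferentiableAt ℝ (gradient ψ) u :=
    ((contDiffOn_gradient hΩ hψ).differentiableOn one_ne_zero).differentiableAt (hΩ.mem_nhds hu)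
  have hs : HasFDerivAt (fun u => 1 - ‖gradient ψ u‖ ^ 2) _ u :=
    (hg.hasFDerivAt.norm_sq).const_sub 1
  have hX := ((hasDerivAt_inv_sqrt_abs h1).comp_hasFDerivAt u hs).smul hg.hasFDerivAt
  have hX' : fderiv ℝ (normalizedGradient ψ) u = _ := hX.fderiv
  rw [meanCurvature, inv_firstForm hd h1, divergence, hX']
  congr 1
  rw [add_mul, one_mul, Matrix.trace_add, Matrix.smul_mul, Matrix.trace_smul,
    Matrix.trace]
  simp only [Matrix.diag, Matrix.trace, Matrix.mul_apply, secondForm_apply hΩ hψ hu,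
    Matrix.vecMulVec_apply]
  simp only [Function.comp_def, add_apply, smul_apply, PiLp.add_apply, PiLp.smul_apply,
    smul_eq_mul, ContinuousLinearMap.smulRight_apply]
  rw [Finset.sum_add_distrib]
  congr 1
  rw [Finset.sum_comm, Finset.mul_sum]
  refine Finset.sum_congr rfl fun j _ => ?_
  have hinner : (-(2 • (innerSL ℝ) (gradient ψ u) ∘SL fderiv ℝ (gradient ψ) u)) (stdVec j) =
      -2 * ∑ i, gradient ψ u i * (fderiv ℝ (gradient ψ) u (stdVec j)) i := by
    simp [-inner_gradient_left, PiLp.inner_apply, mul_comm]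
  rw [hinner, Finset.mul_sum, Finset.mul_sum, Finset.mul_sum, Finset.sum_mul]
  refine Finset.sum_congr rfl fun i _ => ?_
  ring

/-- The mean curvature estimate for any bound `M` of the normalized gradient. If `H` vanishes
somewhere there is nothing to prove; otherwise `H` has a constant sign on the connected set
`closure D`, so that the integral of `|H|` is the absolute value of that of `H`. -/
lemma exists_isLeast_abs_meanCurvature_le (hn : 1 ≤ n) {D : Set (EuclideanSpace ℝ (Fin n))}
    (hDo : IsOpen D) (hDconn : IsConnected D) (hDc : IsCompact (closure D))
    (hD : HasSmoothBoundary D) (hΩ : IsOpen Ω) (hDΩ : closure D ⊆ Ω) (hψ : ContDiffOn ℝ 2 ψ Ω)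
    (h1 : ∀ u ∈ Ω, 1 - ‖gradient ψ u‖ ^ 2 ≠ 0) {M : ℝ}
    (hM : ∀ u ∈ closure D, ‖gradient ψ u‖ / √|1 - ‖gradient ψ u‖ ^ 2| ≤ M) :
    ∃ h : ℝ, IsLeast ((fun u => |meanCurvature ψ u|) '' closure D) h ∧
      h ≤ (1 / (n : ℝ)) * M * (area (frontier D) / vol (closure D)) := by
  set X := normalizedGradient ψ
  have hn0 : (0 : ℝ) < n := by exact_mod_cast hn
  have hX : ContDiffOn ℝ 1 X Ω := contDiffOn_normalizedGradient hΩ hψ h1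
  have hdivc : ContinuousOn (divergence X) Ω := by
    have := hX.continuousOn_fderiv_of_isOpen hΩ le_rfl
    unfold divergence
    fun_prop
  have hH : ∀ u ∈ Ω, meanCurvature ψ u = (1 / (n : ℝ)) * divergence X u := fun u hu =>
    meanCurvature_eq_divergence hΩ hψ hu (h1 u hu)
  have hHc : ContinuousOn (meanCurvature ψ) (closure D) :=
    ((continuousOn_const.mul hdivc).congr hH).mono hDΩ
  have hXM : ∀ u ∈ closure D, ‖X u‖ ≤ M := fun u hu => by
    rw [norm_normalizedGradient]; exact hM u hu
  obtain ⟨u₀, hu₀⟩ := hDconn.nonempty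
  have hM0 : 0 ≤ M := (norm_nonneg _).trans (hXM u₀ (subset_closure hu₀))
  have hflux : ∀ Z : EuclideanSpace ℝ (Fin n) → EuclideanSpace ℝ (Fin n), ContDiffOn ℝ 1 Z Ω →
      (∀ u ∈ closure D, ‖Z u‖ ≤ M) → ∫ u in D, divergence Z u ≤ M * area (frontier D) := by
    intro Z hZ hZM
    lift M to ℝ≥0 using hM0
    have h := hD.integral_divergence_le hDo hDc hΩ hDΩ hZ hZM
    have hA : area (frontier D) = (μHE[n - 1] (frontier D)).toReal := rfl
    have htop : ((M : ℝ≥0∞) * μHE[n - 1] (frontier D)) ≠ ⊤ :=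
      (ENNReal.mul_lt_top ENNReal.coe_lt_top (hD.area_lt_top hDo hDc)).ne
    have := (ENNReal.ofReal_le_iff_le_toReal htop).1 h
    rwa [ENNReal.toReal_mul, ENNReal.coe_toReal, ← hA] at this
  have hvol : vol (closure D) = volume.real D := by
    rw [vol, measure_closure_of_null_frontier (hD.volume_frontier hn hDo hDc)]; rfl
  have hDfin : volume D < ⊤ := (measure_mono subset_closure).trans_lt hDc.measure_lt_top
  have hvpos : 0 < vol (closure D) := by
    rw [hvol]
    exact ENNReal.toReal_pos (hDo.measure_pos volume hDconn.nonempty).ne' hDfin.ne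
  obtain ⟨v, hv, hvmin⟩ := hDc.exists_isMinOn ⟨u₀, subset_closure hu₀⟩ hHc.abs
  refine ⟨|meanCurvature ψ v|, ⟨mem_image_of_mem _ hv, ?_⟩, ?_⟩
  · rintro _ ⟨w, hw, rfl⟩
    exact hvmin hw
  by_cases hv0 : meanCurvature ψ v = 0
  · rw [hv0, abs_zero]
    have : 0 ≤ area (frontier D) := ENNReal.toReal_nonneg
    positivity
  have hne : ∀ w ∈ closure D, meanCurvature ψ w ≠ 0 := fun w hw h0 => by
    have : |meanCurvature ψ v| ≤ |meanCurvature ψ w| := hvmin hw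
    rw [h0, abs_zero] at this
    exact hv0 (abs_nonpos_iff.1 this)
  have hint : IntegrableOn (divergence X) D :=
    ((hdivc.mono hDΩ).integrableOn_compact hDc).mono_set subset_closure
  have hconst : ∀ Z : EuclideanSpace ℝ (Fin n) → ℝ, IntegrableOn Z D →
      (∀ w ∈ D, n * |meanCurvature ψ v| ≤ Z w) →
      n * |meanCurvature ψ v| * vol (closure D) ≤ ∫ w in D, Z w := fun Z hZ hle => by
    rw [hvol, mul_comm, ← smul_eq_mul, ← setIntegral_const]
    exact setIntegral_mono_on (integrableOn_const hDfin.ne) hZ hDo.measurableSet hle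
  suffices hkey : n * |meanCurvature ψ v| * vol (closure D) ≤ M * area (frontier D) by
    rw [one_div, mul_assoc, ← mul_div_assoc, ← div_eq_inv_mul, div_div, mul_comm (vol _),
      le_div_iff₀ (by positivity)]
    linarith
  have hnH : ∀ w ∈ D, divergence X w = n * meanCurvature ψ w := fun w hw => by
    rw [hH w (hDΩ (subset_closure hw))]
    field_simp
  have hmin : ∀ w ∈ D, n * |meanCurvature ψ v| ≤ n * |meanCurvature ψ w| := fun w hw =>
    mul_le_mul_of_nonneg_left (hvmin (subset_closure hw)) hn0.le
  have hsign : (∀ w ∈ closure D, 0 < meanCurvature ψ w) ∨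
      ∀ w ∈ closure D, meanCurvature ψ w < 0 := by
    by_contra! h
    obtain ⟨⟨a, ha, ha0⟩, b, hb, hb0⟩ := h
    obtain ⟨w, hw, hw0⟩ := hDconn.isPreconnected.closure.intermediate_value ha hb hHc ⟨ha0, hb0⟩
    exact hne w hw hw0
  -- If `H` is negative, the vector field `-X` takes the place of `X`.
  rcases hsign with hpos | hneg
  · refine (hconst _ hint fun w hw => ?_).trans (hflux X hX hXM)
    rw [hnH w hw, ← abs_of_pos (hpos w (subset_closure hw))]
    exact hmin w hw
  · have hdivneg : ∀ w, divergence (-X) w = -divergence X w := fun w => by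
      simp [divergence, fderiv_neg]
    refine (hconst (divergence (-X)) ?_ fun w hw => ?_).trans
      (hflux (-X) hX.neg fun u hu => by rw [Pi.neg_apply, norm_neg]; exact hXM u hu)
    · simp_rw [funext hdivneg]
      exact hint.neg
    · rw [hdivneg, hnH w hw, ← mul_neg, ← abs_of_neg (hneg w (subset_closure hw))]
      exact hmin w hw

/-- The function `t / √|1 - t²|` increases on `[0, 1)`. -/
lemma div_sqrt_abs_one_sub_sq_le_of_lt_one {s t : ℝ} (hs : 0 ≤ s) (hst : s ≤ t) (ht : t < 1) :
    s / √|1 - s ^ 2| ≤ t / √|1 - t ^ 2| := by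
  have h1 : 0 < 1 - t ^ 2 := by nlinarith
  have h2 : 1 - t ^ 2 ≤ 1 - s ^ 2 := by nlinarith
  rw [abs_of_pos h1, abs_of_pos (h1.trans_le h2)]
  exact div_le_div₀ (hs.trans hst) hst (Real.sqrt_pos.2 h1) (Real.sqrt_le_sqrt h2)

/-- The function `t / √|1 - t²|` decreases on `(1, ∞)`. -/
lemma div_sqrt_abs_one_sub_sq_le_of_one_lt {s t : ℝ} (hs : 1 < s) (hst : s ≤ t) :
    t / √|1 - t ^ 2| ≤ s / √|1 - s ^ 2| := by
  have h1 : 1 - s ^ 2 < 0 := by nlinarith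
  have h2 : 1 - t ^ 2 < 0 := by nlinarith
  have h3 := abs_pos.2 h1.ne
  have h4 := abs_pos.2 h2.ne
  rw [div_le_div_iff₀ (Real.sqrt_pos.2 h4) (Real.sqrt_pos.2 h3)]
  refine abs_le_of_sq_le_sq' ?_ (by positivity) |>.2
  rw [mul_pow, mul_pow, Real.sq_sqrt h3.le, Real.sq_sqrt h4.le, abs_of_neg h1, abs_of_neg h2]
  nlinarith

end Curvature

end LorentzGraph

theorem mainTheorem3 (n : ℕ) (hn : 1 ≤ n)
    (D Ω : Set (EuclideanSpace ℝ (Fin n)))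
    (hDopen : IsOpen D) (hDconn : IsConnected D) (hDcomp : IsCompact (closure D))
    (hDsmooth : LorentzGraph.HasSmoothBoundary D)
    (hΩ : IsOpen Ω) (hDΩ : closure D ⊆ Ω)
    (ψ : EuclideanSpace ℝ (Fin n) → ℝ) (hψ : ContDiffOn ℝ 2 ψ Ω) :
    (μHE[n - 1] : MeasureTheory.Measure (EuclideanSpace ℝ (Fin n))) (frontier D) ≠ ⊤ ∧
    (LorentzGraph.IsSpaceLike ψ Ω →
      ∃ m h : ℝ, IsGreatest ((fun u => ‖gradient ψ u‖) '' closure D) m ∧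
        IsLeast ((fun u => |LorentzGraph.meanCurvature ψ u|) '' closure D) h ∧
        h ≤ (1 / (n : ℝ)) * (m / √|1 - m ^ 2|) *
          (LorentzGraph.area (frontier D) / LorentzGraph.vol (closure D))) ∧
    (LorentzGraph.IsTimeLike ψ Ω →
      ∃ m h : ℝ, IsLeast ((fun u => ‖gradient ψ u‖) '' closure D) m ∧
        IsLeast ((fun u => |LorentzGraph.meanCurvature ψ u|) '' closure D) h ∧
        h ≤ (1 / (n : ℝ)) * (m / √|1 - m ^ 2|) *
          (LorentzGraph.area (frontier D) / LorentzGraph.vol (closure D))) := by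
  have hgc : ContinuousOn (fun u => ‖gradient ψ u‖) (closure D) :=
    ((LorentzGraph.contDiffOn_gradient hΩ hψ).continuousOn.mono hDΩ).norm
  have hd : ∀ u ∈ Ω, DifferentiableAt ℝ ψ u := fun u hu =>
    (hψ.differentiableOn two_ne_zero).differentiableAt (hΩ.mem_nhds hu)
  have hne : (closure D).Nonempty := hDconn.nonempty.closure
  refine ⟨(hDsmooth.area_lt_top hDopen hDcomp).ne, fun hs => ?_, fun ht => ?_⟩
  · have hlt : ∀ u ∈ Ω, ‖gradient ψ u‖ < 1 := fun u hu => hs.norm_gradient_lt_one hu (hd u hu)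
    obtain ⟨v, hv, hmax⟩ := hDcomp.exists_isMaxOn hne hgc
    obtain ⟨h, hh, hle⟩ := LorentzGraph.exists_isLeast_abs_meanCurvature_le hn hDopen hDconn hDcomp
      hDsmooth hΩ hDΩ hψ (fun u hu => by nlinarith [hlt u hu, norm_nonneg (gradient ψ u)])
      fun u hu => LorentzGraph.div_sqrt_abs_one_sub_sq_le_of_lt_one (norm_nonneg _) (hmax hu)
        (hlt v (hDΩ hv))
    exact ⟨_, h, ⟨Set.mem_image_of_mem _ hv, Set.forall_mem_image.2 fun u hu => hmax hu⟩, hh, hle⟩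
  · have hlt : ∀ u ∈ Ω, 1 < ‖gradient ψ u‖ := fun u hu => ht.one_lt_norm_gradient hu (hd u hu)
    obtain ⟨v, hv, hmin⟩ := hDcomp.exists_isMinOn hne hgc
    obtain ⟨h, hh, hle⟩ := LorentzGraph.exists_isLeast_abs_meanCurvature_le hn hDopen hDconn hDcomp
      hDsmooth hΩ hDΩ hψ (fun u hu => by nlinarith [hlt u hu])
      fun u hu => LorentzGraph.div_sqrt_abs_one_sub_sq_le_of_one_lt (hlt v (hDΩ hv)) (hmin hu)
    exact ⟨_, h, ⟨Set.mem_image_of_mem _ hv, Set.forall_mem_image.2 fun u hu => hmin hu⟩, hh, hle⟩
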